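/- Theorem 3.1. Let $\mathbb N=\{1,2,\dots\}$ and let $l^\infty$ be the Banach space of bounded real functions on $\mathbb N$. Let $\beta\mathbb N$ be the space of all ultrafilters on $\mathbb N$ (the Stone–Čech compactification of $\mathbb N$), let $\mathbb N^*=\beta\mathbb N\setminus\mathbb N$ be the set of free ultrafilters, and let $\tau:\beta\mathbb N\to\beta\mathbb N$ be the continuous extension of $n\mapsto n+1$. For an ultrafilter $\mathcal U$ on $\mathbb N$ and a bounded function $g:\mathbb N\to\mathbb R$, $\mathcal U\text{-}\lim_n g(n)$ denotes the unique real $\alpha$ such that $\{n:|g(n)-\alpha|<\varepsilon\}\in\mathcal U$ for every $\varepsilon>0$. Let $\tilde{\mathcal C}\subset (l^\infty)^*$ be the set of all functionals $$\varphi^{\mathcal U}(f)=\mathcal U\text{-}\lim_n \frac1n\sum_{i=1}^n f(i)\qquad(f\in l^\infty),\quad \mathcal U\in\mathbb N^*,$$ with the topology induced by the weak* topology of $(l^\infty)^*$. Let $\Omega$ be the quotient space of $\beta\mathbb N\times[0,1]$ obtained by identifying $(\eta,1)$ with $(\tau\eta,0)$ for every $\eta\in\beta\mathbb N$, and let $\Omega^*\subset\Omega$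 be the subspace of all points $(\eta,t)$ with $\eta\in\mathbb N^*$ (the suspension of $(\mathbb N^*,\tau)$). For $\omega=(\eta,t)\in\Omega^*$ and $\theta=2^t$ put $$\varphi_\omega(f)=\eta\text{-}\lim_n \frac{1}{\theta\cdot 2^n}\sum_{i=1}^{[\theta\cdot 2^n]} f(i)\qquad(f\in l^\infty),$$ where $[x]$ is the integer part of $x$; this depends only on the point $\omega$ of $\Omega^*$, not on the pair $(\eta,t)$ representing it. Then for every $\varphi\in\tilde{\mathcal C}$ there is exactly one $\omega\in\Omega^*$ with $\varphi=\varphi_\omega$, and the map $\omega\mapsto\varphi_\omega$ is a homeomorphism from $\Omega^*$ onto $\tilde{\mathcal C}$. -/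

import Mathlib

open Filter Topology
open scoped ENNReal

/-- The Banach space of bounded real functions on the positive integers. -/
abbrev LInf : Type := lp (fun _ : ℕ+ => ℝ) ∞

/-- The limit of a real function along an ultrafilter. It exists for bounded functions,
see `tendsto_uLim`. -/
noncomputable def uLim {X : Type*} (U : Ultrafilter X) (g : X → ℝ) : ℝ :=
  limUnder (U : Filter X) g

theorem tendsto_uLim {X : Type*} (U : Ultrafilter X) (g : X → ℝ) (C : ℝ)
    (h : ∀ x, |g x| ≤ C) : Tendsto g U (𝓝 (uLim U g)) := by
  have hmem : ((U.map g : Ultrafilter ℝ) : Filter ℝ) ≤ 𝓟 (Set.Icc (-C) C) := by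
    rw [le_principal_iff, Ultrafilter.coe_map, mem_map]
    exact univ_mem' fun x => abs_le.1 (h x)
  obtain ⟨a, -, ha⟩ := isCompact_Icc.ultrafilter_le_nhds (U.map g) hmem
  exact tendsto_nhds_limUnder ⟨a, by simpa [Tendsto] using ha⟩

theorem uLim_eq {X : Type*} (U : Ultrafilter X) (g : X → ℝ) (a : ℝ)
    (h : Tendsto g U (𝓝 a)) : uLim U g = a :=
  h.limUnder_eq

/-- The sum `f(1) + ... + f(m)`. -/
noncomputable def partialSum (f : LInf) (m : ℕ) : ℝ :=
  ∑ i ∈ Finset.range m, f i.succPNat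

theorem abs_partialSum_le (f : LInf) (m : ℕ) : |partialSum f m| ≤ m * ‖f‖ := by
  unfold partialSum
  refine (Finset.abs_sum_le_sum_abs _ _).trans ?_
  refine (Finset.sum_le_card_nsmul _ _ ‖f‖ fun i _ => ?_).trans (by simp)
  exact lp.norm_apply_le_norm ENNReal.top_ne_zero f i.succPNat

theorem abs_mean_le (f : LInf) (a : ℝ) (m : ℕ) (h : (m : ℝ) ≤ a) :
    |1 / a * partialSum f m| ≤ ‖f‖ := by
  have ha : 0 ≤ a := (Nat.cast_nonneg m).trans h
  rw [abs_mul, abs_of_nonneg (by positivity)]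
  calc 1 / a * |partialSum f m| ≤ 1 / a * (a * ‖f‖) := by
        gcongr
        exact (abs_partialSum_le f m).trans (by gcongr)
    _ = (a / a) * ‖f‖ := by ring
    _ ≤ 1 * ‖f‖ := by gcongr; exact div_self_le_one a
    _ = ‖f‖ := one_mul _

/-- The functional `f ↦ U-lim_n (1 / a n) * (f(1) + ... + f(m n))` on bounded functions, where
`m n ≤ a n`, as a point of the dual space with the weak-* topology. -/
noncomputable def limMean (U : Ultrafilter ℕ+) (a : ℕ+ → ℝ) (m : ℕ+ → ℕ)
    (h : ∀ n, (m n : ℝ) ≤ a n) : WeakDual ℝ LInf :=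
  StrongDual.toWeakDual <| LinearMap.mkContinuous
    { toFun := fun f => uLim U fun n => 1 / a n * partialSum f (m n)
      map_add' := fun f g => by
        apply uLim_eq
        refine ((tendsto_uLim U _ _ fun n => abs_mean_le f (a n) (m n) (h n)).add
          (tendsto_uLim U _ _ fun n => abs_mean_le g (a n) (m n) (h n))).congr fun n => ?_
        simp [partialSum, Finset.sum_add_distrib, mul_add]
      map_smul' := fun c f => by
        apply uLim_eq
        refine ((tendsto_uLim U _ _ fun n =>
          abs_mean_le f (a n) (m n) (h n)).const_mul c).congr fun n => ?_
        simp only [partialSum, lp.coeFn_smul, Pi.smul_apply, smul_eq_mul, ← Finset.mul_sum]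
        ring }
    1 fun f => by
      rw [one_mul]
      exact le_of_tendsto (tendsto_uLim U _ _ fun n => abs_mean_le f (a n) (m n) (h n)).norm
        (Eventually.of_forall fun n => abs_mean_le f (a n) (m n) (h n))

theorem limMean_apply (U : Ultrafilter ℕ+) (a : ℕ+ → ℝ) (m : ℕ+ → ℕ)
    (h : ∀ n, (m n : ℝ) ≤ a n) (f : LInf) :
    limMean U a m h f = uLim U fun n => 1 / a n * partialSum f (m n) := rfl

/-- The set of free ultrafilters on the positive integers: the remainder of the Stone-Čech
compactification `Ultrafilter ℕ+`. -/
def NStar : Set (Ultrafilter ℕ+) := (Set.range (pure : ℕ+ → Ultrafilter ℕ+))ᶜ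

/-- The functional `f ↦ U-lim_n (1 / n) * (f(1) + ... + f(n))`. -/
noncomputable def cesaroLim (U : Ultrafilter ℕ+) : WeakDual ℝ LInf :=
  limMean U (fun n => (n : ℝ)) (fun n => (n : ℕ)) fun _ => le_rfl

/-- The set of all Cesàro limits along free ultrafilters. As a subtype it carries the topology
induced by the weak-* topology. -/
def CTilde : Set (WeakDual ℝ LInf) := cesaroLim '' NStar

/-- The extension to `Ultrafilter ℕ+` of the translation `n ↦ n + 1`. -/
def tau (η : Ultrafilter ℕ+) : Ultrafilter ℕ+ := η.map (· + 1)

/-- The identification of `(η, 1)` with `(τ η, 0)`. -/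
def glue (p q : Ultrafilter ℕ+ × Set.Icc (0 : ℝ) 1) : Prop :=
  p.2 = 1 ∧ q = (tau p.1, 0)

/-- The quotient space of `βℕ × [0, 1]` under the identification of `(η, 1)` with `(τ η, 0)`
(that is, by the equivalence relation generated by `glue`). -/
abbrev Omega : Type := Quot glue

/-- The subspace of the points `(η, t)` with `η` free. -/
def OmegaStar : Set Omega := {ω | ∃ η ∈ NStar, ∃ t, ω = Quot.mk glue (η, t)}

/-- The functional `f ↦ η-lim_n (1 / (θ * 2 ^ n)) * (f(1) + ... + f([θ * 2 ^ n]))`, where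
`θ = 2 ^ t`. -/
noncomputable def phiPair (η : Ultrafilter ℕ+) (t : ℝ) : WeakDual ℝ LInf :=
  limMean η (fun n => (2 : ℝ) ^ t * 2 ^ (n : ℕ)) (fun n => ⌊(2 : ℝ) ^ t * 2 ^ (n : ℕ)⌋₊)
    fun _ => Nat.floor_le (by positivity)

theorem phiPair_glue (η : Ultrafilter ℕ+) : phiPair η 1 = phiPair (tau η) 0 := by
  refine DFunLike.ext _ _ fun f => ?_
  unfold phiPair
  rw [limMean_apply, limMean_apply]
  apply uLim_eq
  have h := tendsto_uLim (tau η)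
    (fun n : ℕ+ => 1 / ((2 : ℝ) ^ (0 : ℝ) * 2 ^ (n : ℕ)) *
      partialSum f ⌊(2 : ℝ) ^ (0 : ℝ) * 2 ^ (n : ℕ)⌋₊) ‖f‖
    fun n => abs_mean_le f _ _ (Nat.floor_le (by positivity))
  rw [tau, Ultrafilter.coe_map, tendsto_map'_iff] at h
  refine h.congr fun n => ?_
  have e : (2 : ℝ) ^ (0 : ℝ) * 2 ^ ((n + 1 : ℕ+) : ℕ) = (2 : ℝ) ^ (1 : ℝ) * 2 ^ (n : ℕ) := by
    rw [Real.rpow_zero, Real.rpow_one, PNat.add_coe, PNat.one_coe, pow_succ]; ring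
  simp only [Function.comp_apply, e]

/-- The functional attached to the point `ω = (η, t)`. -/
noncomputable def phi : Omega → WeakDual ℝ LInf :=
  Quot.lift (fun p => phiPair p.1 p.2) (by
    rintro ⟨η, t⟩ q ⟨ht, rfl⟩
    have ht' : t = 1 := ht
    subst ht'
    exact phiPair_glue η)

/-!
The proof rests on one estimate. With `mean f x = (f 1 + ⋯ + f ⌊x⌋) / x`, the difference
`mean f x - mean f y` is small as soon as `x / y` is close to `1` and `x` is large
(`abs_mean_sub_mean_le`); hence a limit of means along an ultrafilter only depends on the scale up
to asymptotic equivalence (`tendsto_mean_sub_mean`).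

* The functionals of Cesàro type are exactly the `phi ω`: rounding `2 ^ t * 2 ^ n` to an integer
  turns `phiPair η t` into a Cesàro limit, and conversely `n = 2 ^ k * 2 ^ s` with `k = ⌊log₂ n⌋`,
  so that a Cesàro limit along `U` is `phiPair η t`, where `η` is the image of `U` under `k` and
  `t` is the limit of `s` along `U`.
* `phi` is injective: given a bounded Lipschitz function `h` on `ℝ`, the function `f` with partial
  sums `m * h (log₂ m)` is bounded, and `phiPair η t f` is the limit of `h (n + t)` along `η`
  (`exists_tendsto_phiPair`). Two distinct points with `t, t' ∈ [0, 1)` are told apart by a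
  truncated distance to a set `A + t` with `A ∈ η`.
* `phi` is continuous on `OmegaStar`. This set is closed and its preimage in `βℕ × [0, 1]` consists
  of all pairs with `η` free, so continuity can be checked on such pairs. There `phiPair η t f` is
  continuous in `η` for fixed `t`, and by the estimate above it is continuous in `t` uniformly in
  `η`; principal `η` have to be excluded, because of the jumps of `⌊2 ^ t * 2 ^ n⌋`.

A continuous bijection from a compact space onto a Hausdorff space is a homeomorphism.
-/

/-! ### Free ultrafilters -/

theorem mem_NStar_iff {η : Ultrafilter ℕ+} :
    η ∈ NStar ↔ Tendsto (fun n : ℕ+ => (n : ℝ)) η atTop := by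
  constructor
  · intro h
    have hc : (η : Filter ℕ+) ≤ cofinite := by
      rcases η.le_cofinite_or_eq_pure with h' | ⟨n, hn⟩
      · exact h'
      · exact absurd ⟨n, hn.symm⟩ h
    have h1 : Tendsto (fun n : ℕ+ => (n : ℕ)) η atTop :=
      Nat.cofinite_eq_atTop ▸ PNat.coe_injective.tendsto_cofinite.mono_left hc
    exact tendsto_natCast_atTop_atTop.comp h1
  · rintro h ⟨k, rfl⟩
    have h1 := h.eventually_gt_atTop (k : ℝ)
    rw [Ultrafilter.coe_pure, eventually_pure] at h1
    exact lt_irrefl _ h1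

theorem map_mem_NStar_iff {η : Ultrafilter ℕ+} {m : ℕ+ → ℕ+} :
    η.map m ∈ NStar ↔ Tendsto (fun n => (m n : ℝ)) η atTop := by
  rw [mem_NStar_iff, Ultrafilter.coe_map, tendsto_map'_iff]
  rfl

theorem tau_mem_NStar_iff {η : Ultrafilter ℕ+} : tau η ∈ NStar ↔ η ∈ NStar := by
  rw [tau, map_mem_NStar_iff, mem_NStar_iff]
  simp only [PNat.add_coe, PNat.one_coe, Nat.cast_add, Nat.cast_one]
  exact ⟨fun h => by simpa using tendsto_atTop_add_const_right _ (-1) h,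
    fun h => tendsto_atTop_add_const_right _ 1 h⟩

theorem isClosed_NStar : IsClosed NStar := by
  rw [← isOpen_compl_iff, NStar, compl_compl]
  have : Set.range (pure : ℕ+ → Ultrafilter ℕ+) = ⋃ n, {u : Ultrafilter ℕ+ | {n} ∈ u} := by
    ext u
    simp only [Set.mem_range, Set.mem_iUnion, Set.mem_ofPred_eq]
    refine exists_congr fun n => ⟨?_, fun h => ?_⟩
    · rintro rfl
      exact Ultrafilter.mem_pure.2 rfl
    · exact (Ultrafilter.coe_le_coe.1 (le_pure_iff.2 h)).symm
  rw [this]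
  exact isOpen_iUnion fun n => ultrafilter_isOpen_basic _

theorem continuous_uLim {X : Type*} (g : X → ℝ) (C : ℝ) (hg : ∀ x, |g x| ≤ C) :
    Continuous fun U : Ultrafilter X => uLim U g := by
  refine continuous_iff_continuousAt.2 fun U => Metric.tendsto_nhds.2 fun ε hε => ?_
  have hA : {x | |g x - uLim U g| < ε / 2} ∈ U :=
    Metric.tendsto_nhds.1 (tendsto_uLim U g C hg) (ε / 2) (half_pos hε)
  filter_upwards [(ultrafilter_isOpen_basic _).mem_nhds hA] with V hV
  refine lt_of_le_of_lt ?_ (half_lt_self hε)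
  refine le_of_tendsto ((tendsto_uLim V g C hg).dist tendsto_const_nhds) ?_
  filter_upwards [hV] with x hx using hx.le

/-! ### Means of bounded functions -/

/-- The mean `(f(1) + ... + f([x])) / x` at a real scale `x`. -/
noncomputable def mean (f : LInf) (x : ℝ) : ℝ := 1 / x * partialSum f ⌊x⌋₊

theorem abs_mean_le_norm (f : LInf) {x : ℝ} (hx : 0 ≤ x) : |mean f x| ≤ ‖f‖ :=
  abs_mean_le f x _ (Nat.floor_le hx)

theorem tendsto_uLim_mean {X : Type*} (U : Ultrafilter X) (f : LInf) {a : X → ℝ}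
    (ha : ∀ x, 0 < a x) :
    Tendsto (fun x => mean f (a x)) U (𝓝 (uLim U fun x => mean f (a x))) :=
  tendsto_uLim U _ ‖f‖ fun x => abs_mean_le_norm f (ha x).le

theorem phiPair_apply (η : Ultrafilter ℕ+) (t : ℝ) (f : LInf) :
    phiPair η t f = uLim η fun n => mean f ((2 : ℝ) ^ t * 2 ^ (n : ℕ)) := rfl

theorem cesaroLim_apply (U : Ultrafilter ℕ+) (f : LInf) :
    cesaroLim U f = uLim U fun n => mean f (n : ℝ) := by
  unfold mean
  simp only [Nat.floor_natCast]
  rfl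

theorem abs_partialSum_sub_le (f : LInf) {m n : ℕ} (h : m ≤ n) :
    |partialSum f n - partialSum f m| ≤ (n - m) * ‖f‖ := by
  unfold partialSum
  rw [← Finset.sum_Ico_eq_sub _ h]
  refine (Finset.abs_sum_le_sum_abs _ _).trans ?_
  refine (Finset.sum_le_card_nsmul _ _ ‖f‖ fun i _ => ?_).trans (by simp [Nat.cast_sub h])
  exact lp.norm_apply_le_norm ENNReal.top_ne_zero f i.succPNat

theorem abs_mean_sub_mean_le_of_le (f : LInf) {x y : ℝ} (hx : 0 < x) (hxy : x ≤ y) :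
    |mean f x - mean f y| ≤ ‖f‖ * ((2 * (y - x) + 1) / y) := by
  have hy : 0 < y := hx.trans_le hxy
  have hfx := Nat.lt_floor_add_one x
  have hfy := Nat.floor_le hy.le
  have h1 : mean f x - mean f y = (1 - x / y) * mean f x
      - 1 / y * (partialSum f ⌊y⌋₊ - partialSum f ⌊x⌋₊) := by
    unfold mean
    field_simp
    ring
  have h2 : |(1 - x / y) * mean f x| ≤ (1 - x / y) * ‖f‖ := by
    have h0 : 0 ≤ 1 - x / y := sub_nonneg.2 ((div_le_one hy).2 hxy)
    rw [abs_mul, abs_of_nonneg h0]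
    exact mul_le_mul_of_nonneg_left (abs_mean_le_norm f hx.le) h0
  have h3 : |1 / y * (partialSum f ⌊y⌋₊ - partialSum f ⌊x⌋₊)| ≤ 1 / y * ((y - x + 1) * ‖f‖) := by
    rw [abs_mul, abs_of_nonneg (by positivity : 0 ≤ 1 / y)]
    gcongr
    refine (abs_partialSum_sub_le f (Nat.floor_mono hxy)).trans ?_
    gcongr
    linarith
  calc |mean f x - mean f y| ≤ (1 - x / y) * ‖f‖ + 1 / y * ((y - x + 1) * ‖f‖) := by
        rw [h1]
        exact (abs_sub _ _).trans (add_le_add h2 h3)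
    _ = ‖f‖ * ((2 * (y - x) + 1) / y) := by
        field_simp
        ring

theorem abs_mean_sub_mean_le (f : LInf) {x y : ℝ} (hx : 0 < x) (hy : 0 < y) :
    |mean f x - mean f y| ≤ ‖f‖ * ((2 * |x - y| + 1) / x) := by
  rcases le_total x y with h | h
  · rw [abs_sub_comm x y, abs_of_nonneg (sub_nonneg.2 h)]
    refine (abs_mean_sub_mean_le_of_le f hx h).trans ?_
    have := sub_nonneg.2 h
    gcongr
  · rw [abs_sub_comm, abs_of_nonneg (sub_nonneg.2 h)]
    exact abs_mean_sub_mean_le_of_le f hy h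

/-- Asymptotically equivalent scales have the same limits of means. -/
theorem tendsto_mean_sub_mean {X : Type*} {l : Filter X} (f : LInf) {a b : X → ℝ}
    (ha : ∀ x, 0 < a x) (hb : ∀ x, 0 < b x) (hat : Tendsto a l atTop)
    (hba : Tendsto (fun x => b x / a x) l (𝓝 1)) :
    Tendsto (fun x => mean f (a x) - mean f (b x)) l (𝓝 0) := by
  have h : Tendsto (fun x => ‖f‖ * (2 * |1 - b x / a x| + (a x)⁻¹)) l (𝓝 0) := by
    have := ((((tendsto_const_nhds (x := (1 : ℝ))).sub hba).abs.const_mul 2).add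
      (tendsto_inv_atTop_zero.comp hat)).const_mul ‖f‖
    simpa using this
  refine squeeze_zero_norm (fun x => ?_) h
  refine (abs_mean_sub_mean_le f (ha x) (hb x)).trans_eq ?_
  have h1 : 1 - b x / a x = (a x - b x) / a x := by
    rw [sub_div, div_self (ha x).ne']
  rw [h1, abs_div, abs_of_pos (ha x)]
  ring

theorem uLim_mean_congr {X : Type*} {U : Ultrafilter X} (f : LInf) {a b : X → ℝ}
    (ha : ∀ x, 0 < a x) (hb : ∀ x, 0 < b x) (hat : Tendsto a U atTop)
    (hba : Tendsto (fun x => b x / a x) U (𝓝 1)) :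
    uLim U (fun x => mean f (a x)) = uLim U fun x => mean f (b x) := by
  apply uLim_eq
  simpa using (tendsto_mean_sub_mean f ha hb hat hba).add (tendsto_uLim_mean U f hb)

theorem two_rpow_mul_pow_pos (t : ℝ) (n : ℕ) : 0 < (2 : ℝ) ^ t * 2 ^ n := by positivity

theorem tendsto_two_rpow_mul_pow {η : Ultrafilter ℕ+} (hη : η ∈ NStar) (t : ℝ) :
    Tendsto (fun n : ℕ+ => (2 : ℝ) ^ t * 2 ^ (n : ℕ)) η atTop := by
  have h1 : Tendsto (fun n : ℕ+ => (n : ℕ)) η atTop :=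
    tendsto_natCast_atTop_iff.1 (mem_NStar_iff.1 hη)
  exact ((tendsto_pow_atTop_atTop_of_one_lt one_lt_two).comp h1).const_mul_atTop (by positivity)

/-! ### Cesàro limits and the functionals `phiPair` -/

theorem phiPair_mem_CTilde {η : Ultrafilter ℕ+} (hη : η ∈ NStar) {t : ℝ} (ht : 0 ≤ t) :
    phiPair η t ∈ CTilde := by
  have hpos : ∀ n : ℕ+, 0 < ⌊(2 : ℝ) ^ t * 2 ^ (n : ℕ)⌋₊ := fun n => by
    rw [Nat.floor_pos]
    exact one_le_mul_of_one_le_of_one_le (Real.one_le_rpow one_le_two ht)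
      (one_le_pow₀ one_le_two)
  let m : ℕ+ → ℕ+ := fun n => ⟨⌊(2 : ℝ) ^ t * 2 ^ (n : ℕ)⌋₊, hpos n⟩
  have hat := tendsto_two_rpow_mul_pow hη t
  refine ⟨η.map m, map_mem_NStar_iff.2
    (tendsto_natCast_atTop_atTop.comp (tendsto_nat_floor_atTop.comp hat)), ?_⟩
  refine DFunLike.ext _ _ fun f => ?_
  rw [cesaroLim_apply, phiPair_apply,
    uLim_mean_congr f (b := fun n => (m n : ℝ)) (fun n => two_rpow_mul_pow_pos t n)
      (fun n => Nat.cast_pos.2 (hpos n)) hat ((tendsto_nat_floor_div_atTop (R := ℝ)).comp hat)]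
  apply uLim_eq
  rw [Ultrafilter.coe_map, tendsto_map'_iff]
  exact tendsto_uLim_mean η f (a := fun n => (m n : ℝ)) fun n => Nat.cast_pos.2 (hpos n)

theorem exists_phiPair_eq_cesaroLim {U : Ultrafilter ℕ+} (hU : U ∈ NStar) :
    ∃ η ∈ NStar, ∃ t ∈ Set.Icc (0 : ℝ) 1, phiPair η t = cesaroLim U := by
  have hcast := mem_NStar_iff.1 hU
  have hlog : Tendsto (fun n : ℕ+ => Real.logb 2 (n : ℝ)) U atTop :=
    (Real.tendsto_logb_atTop one_lt_two).comp hcast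
  have hlt : ∀ n : ℕ+, Real.logb 2 (n : ℝ) < Nat.log 2 n + 1 := fun n => by
    rw [Real.logb_lt_iff_lt_rpow one_lt_two (Nat.cast_pos.2 n.pos)]
    exact_mod_cast Nat.lt_pow_succ_log_self one_lt_two (n : ℕ)
  have hle : ∀ n : ℕ+, (Nat.log 2 n : ℝ) ≤ Real.logb 2 (n : ℝ) := fun n => by
    rw [Real.le_logb_iff_rpow_le one_lt_two (Nat.cast_pos.2 n.pos)]
    exact_mod_cast Nat.pow_log_le_self 2 n.ne_zero
  let s : ℕ+ → ℝ := fun n => Real.logb 2 (n : ℝ) - Nat.log 2 n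
  have hs : ∀ n, s n ∈ Set.Icc (0 : ℝ) 1 := fun n =>
    ⟨sub_nonneg.2 (hle n), by have := hlt n; simp only [s]; linarith⟩
  obtain ⟨t, ht, hst⟩ := isCompact_Icc.ultrafilter_le_nhds (U.map s)
    (by
      rw [le_principal_iff, Ultrafilter.coe_map, mem_map]
      exact univ_mem' hs)
  replace hst : Tendsto s U (𝓝 t) := by simpa [Tendsto] using hst
  -- `toPNat'` sends `Nat.log 2 1 = 0` to `1`; this only matters for `n = 1`.
  let k : ℕ+ → ℕ+ := fun n => (Nat.log 2 n).toPNat'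
  have hk : ∀ n : ℕ+, 2 ≤ (n : ℕ) → (k n : ℕ) = Nat.log 2 n := fun n hn => by
    simp only [k, Nat.toPNat'_coe, if_pos (Nat.log_pos one_lt_two hn)]
  have hn2 : ∀ᶠ n : ℕ+ in U, 2 ≤ (n : ℕ) :=
    (tendsto_natCast_atTop_iff.1 hcast).eventually_ge_atTop 2
  have hη : U.map k ∈ NStar := by
    rw [map_mem_NStar_iff]
    refine tendsto_atTop_mono' _ ?_ (tendsto_atTop_add_const_right _ (-1) hlog)
    filter_upwards [hn2] with n hn
    rw [hk n hn]
    have := hlt n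
    linarith
  refine ⟨U.map k, hη, t, ht, DFunLike.ext _ _ fun f => ?_⟩
  have hat : Tendsto (fun n : ℕ+ => (2 : ℝ) ^ t * 2 ^ (k n : ℕ)) U atTop := by
    have := tendsto_two_rpow_mul_pow hη t
    rwa [Ultrafilter.coe_map, tendsto_map'_iff] at this
  have hba : Tendsto (fun n : ℕ+ => (n : ℝ) / ((2 : ℝ) ^ t * 2 ^ (k n : ℕ))) U (𝓝 1) := by
    have h0 : Tendsto (fun n => (2 : ℝ) ^ (s n - t)) U (𝓝 1) := by
      have h1 : Tendsto (fun n => s n - t) U (𝓝 0) := by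
        simpa using hst.sub (tendsto_const_nhds (x := t))
      simpa using (tendsto_const_nhds (x := (2 : ℝ))).rpow h1 (Or.inl two_ne_zero)
    refine h0.congr' ?_
    filter_upwards [hn2] with n hn
    rw [hk n hn, Real.rpow_sub two_pos, Real.rpow_sub two_pos,
      Real.rpow_logb two_pos (by norm_num) (Nat.cast_pos.2 n.pos), Real.rpow_natCast,
      div_div, mul_comm]
  rw [cesaroLim_apply, phiPair_apply,
    ← uLim_mean_congr f (fun n => two_rpow_mul_pow_pos t (k n)) (fun n => Nat.cast_pos.2 n.pos)
      hat hba]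
  apply uLim_eq
  rw [Ultrafilter.coe_map, tendsto_map'_iff]
  exact tendsto_uLim_mean U f fun n => two_rpow_mul_pow_pos t (k n)

/-! ### Separation of the functionals `phiPair` -/

/-- If `h` is bounded and Lipschitz, then `x ↦ x * h (log₂ x)` is Lipschitz on `[0, ∞)`. -/
theorem abs_mul_comp_logb_sub_le {h : ℝ → ℝ} (hb : ∀ x, |h x| ≤ 1) (hL : LipschitzWith 1 h)
    {x y : ℝ} (hx : 0 ≤ x) (hxy : x ≤ y) :
    |y * h (Real.logb 2 y) - x * h (Real.logb 2 x)| ≤ (1 + 1 / Real.log 2) * (y - x) := by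
  have hl2 : 0 < Real.log 2 := Real.log_pos one_lt_two
  have hd : 0 ≤ y - x := sub_nonneg.2 hxy
  have h1 : |(y - x) * h (Real.logb 2 y)| ≤ y - x := by
    rw [abs_mul, abs_of_nonneg hd]
    exact mul_le_of_le_one_right hd (hb _)
  have h2 : |x * (h (Real.logb 2 y) - h (Real.logb 2 x))| ≤ 1 / Real.log 2 * (y - x) := by
    rcases hx.eq_or_lt with rfl | hx'
    · rw [zero_mul, abs_zero]
      positivity
    have hy : 0 < y := hx'.trans_le hxy
    have h3 : |h (Real.logb 2 y) - h (Real.logb 2 x)| ≤ Real.logb 2 y - Real.logb 2 x := by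
      have := hL.dist_le_mul (Real.logb 2 y) (Real.logb 2 x)
      rwa [NNReal.coe_one, one_mul, Real.dist_eq, Real.dist_eq, abs_of_nonneg
        (sub_nonneg.2 (Real.logb_le_logb_of_le one_lt_two hx' hxy))] at this
    have h4 : Real.log y - Real.log x ≤ y / x - 1 := by
      rw [← Real.log_div hy.ne' hx'.ne']
      exact Real.log_le_sub_one_of_pos (by positivity)
    rw [abs_mul, abs_of_pos hx']
    calc x * |h (Real.logb 2 y) - h (Real.logb 2 x)|
        ≤ x * (Real.logb 2 y - Real.logb 2 x) := by gcongr
      _ = x * ((Real.log y - Real.log x) / Real.log 2) := by rw [sub_div]; rfl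
      _ ≤ x * ((y / x - 1) / Real.log 2) := by gcongr
      _ = 1 / Real.log 2 * (y - x) := by field_simp
  calc |y * h (Real.logb 2 y) - x * h (Real.logb 2 x)|
      = |(y - x) * h (Real.logb 2 y) + x * (h (Real.logb 2 y) - h (Real.logb 2 x))| := by
        congr 1
        ring
    _ ≤ (y - x) + 1 / Real.log 2 * (y - x) := (abs_add_le _ _).trans (add_le_add h1 h2)
    _ = (1 + 1 / Real.log 2) * (y - x) := by ring

/-- Every bounded Lipschitz function `h` of the logarithmic scale can be read off from the means
of a bounded function, namely the one with partial sums `m * h (log₂ m)`. -/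
theorem exists_tendsto_phiPair {h : ℝ → ℝ} (hb : ∀ x, |h x| ≤ 1) (hL : LipschitzWith 1 h) :
    ∃ f : LInf, ∀ η ∈ NStar, ∀ t : ℝ,
      Tendsto (fun n : ℕ+ => h ((n : ℕ) + t)) η (𝓝 (phiPair η t f)) := by
  let G : ℝ → ℝ := fun x => x * h (Real.logb 2 x)
  let F : ℕ+ → ℝ := fun i => G (i : ℕ) - G ((i : ℕ) - 1)
  have hF : Memℓp F ∞ := by
    refine memℓp_infty ⟨1 + 1 / Real.log 2, ?_⟩
    rintro _ ⟨i, rfl⟩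
    have hi : (1 : ℝ) ≤ (i : ℕ) := Nat.one_le_cast.2 i.pos
    refine (abs_mul_comp_logb_sub_le hb hL (sub_nonneg.2 hi) (by linarith)).trans_eq ?_
    ring
  let f : LInf := ⟨F, hF⟩
  have hsum : ∀ m : ℕ, partialSum f m = G m := fun m => by
    have h1 : partialSum f m = ∑ i ∈ Finset.range m, (G ((i + 1 : ℕ) : ℝ) - G (i : ℝ)) := by
      refine Finset.sum_congr rfl fun i _ => ?_
      change G ((i.succPNat : ℕ) : ℝ) - G (((i.succPNat : ℕ) : ℝ) - 1) = _
      simp [Nat.succPNat_coe]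
    rw [h1, Finset.sum_range_sub (fun i : ℕ => G (i : ℝ))]
    simp [G]
  have hmean : ∀ x : ℝ, 0 < x →
      |h (Real.logb 2 x) - mean f x| ≤ (1 + 1 / Real.log 2) * x⁻¹ := fun x hx => by
    have hl2 : 0 < Real.log 2 := Real.log_pos one_lt_two
    have h1 : h (Real.logb 2 x) - mean f x = (G x - G (⌊x⌋₊ : ℝ)) * x⁻¹ := by
      rw [mean, hsum]
      simp only [G]
      field_simp
    rw [h1, abs_mul, abs_of_pos (inv_pos.2 hx)]
    gcongr
    refine (abs_mul_comp_logb_sub_le hb hL (Nat.cast_nonneg _) (Nat.floor_le hx.le)).trans ?_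
    refine mul_le_of_le_one_right (by positivity) ?_
    have := Nat.lt_floor_add_one x
    linarith
  refine ⟨f, fun η hη t => ?_⟩
  have hat := tendsto_two_rpow_mul_pow hη t
  have hd : Tendsto (fun n : ℕ+ => h ((n : ℕ) + t) - mean f ((2 : ℝ) ^ t * 2 ^ (n : ℕ))) η
      (𝓝 0) := by
    have h0 := (tendsto_inv_atTop_zero.comp hat).const_mul (1 + 1 / Real.log 2)
    rw [mul_zero] at h0
    refine squeeze_zero_norm (fun n => ?_) h0
    have h1 : Real.logb 2 ((2 : ℝ) ^ t * 2 ^ (n : ℕ)) = (n : ℕ) + t := by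
      rw [← Real.rpow_natCast 2 (n : ℕ), ← Real.rpow_add two_pos,
        Real.logb_rpow two_pos (by norm_num), add_comm]
    rw [← h1]
    exact hmean _ (two_rpow_mul_pow_pos t n)
  rw [phiPair_apply]
  simpa using hd.add (tendsto_uLim_mean η f fun n : ℕ+ => two_rpow_mul_pow_pos t n)

/-- A member `A` of `η` such that `A + t` stays away from `n + t'` for most `n` with respect
to `η'`. -/
theorem exists_separating_set {η η' : Ultrafilter ℕ+} {t t' : ℝ} (ht : t ∈ Set.Ico (0 : ℝ) 1)
    (ht' : t' ∈ Set.Ico (0 : ℝ) 1) (hne : ¬ (η = η' ∧ t = t')) :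
    ∃ A ∈ η, ∃ δ > 0, δ ≤ 1 ∧ ∀ᶠ n : ℕ+ in η', ∀ a ∈ A,
      δ ≤ |((n : ℕ) + t' : ℝ) - ((a : ℕ) + t)| := by
  obtain ⟨h0, h1⟩ := ht
  obtain ⟨h0', h1'⟩ := ht'
  by_cases htt : t = t'
  · subst htt
    have hηη : ¬ (η : Filter ℕ+) ≤ η' := fun h =>
      hne ⟨(Ultrafilter.coe_le_coe.1 h), rfl⟩
    obtain ⟨B, hB, hBη⟩ : ∃ B ∈ η', B ∉ η := by
      by_contra hcon
      push Not at hcon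
      exact hηη hcon
    refine ⟨Bᶜ, Ultrafilter.compl_mem_iff_notMem.2 hBη, 1, one_pos, le_rfl, ?_⟩
    filter_upwards [hB] with n hn a ha
    have hna : ((n : ℕ) : ℤ) - (a : ℕ) ≠ 0 := fun h => by
      have : n = a := PNat.coe_injective (by omega)
      exact ha (this ▸ hn)
    have := Int.one_le_abs hna
    have h2 : ((n : ℕ) + t : ℝ) - ((a : ℕ) + t) = ((((n : ℕ) : ℤ) - (a : ℕ) : ℤ) : ℝ) := by
      push_cast
      ring
    rw [h2]
    exact_mod_cast this
  · -- Here `n + t' - (a + t)` is an integer plus `t' - t`, and `0 < |t' - t| < 1`.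
    have hpos : 0 < |t' - t| := abs_pos.2 (sub_ne_zero.2 (Ne.symm htt))
    have hlt : |t' - t| < 1 := abs_lt.2 ⟨by linarith, by linarith⟩
    refine ⟨Set.univ, univ_mem, min |t' - t| (1 - |t' - t|), lt_min hpos (sub_pos.2 hlt),
      (min_le_left _ _).trans hlt.le, Eventually.of_forall fun n a _ => ?_⟩
    have h2 : ((n : ℕ) + t' : ℝ) - ((a : ℕ) + t) =
        ((((n : ℕ) : ℤ) - (a : ℕ) : ℤ) : ℝ) + (t' - t) := by
      push_cast
      ring
    rw [h2]
    by_cases hz : (((n : ℕ) : ℤ) - (a : ℕ) : ℤ) = 0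
    · rw [hz, Int.cast_zero, zero_add]
      exact min_le_left _ _
    · have h3 : (1 : ℝ) ≤ |((((n : ℕ) : ℤ) - (a : ℕ) : ℤ) : ℝ)| := by
        exact_mod_cast Int.one_le_abs hz
      refine (min_le_right _ _).trans ?_
      have h4 := abs_sub_abs_le_abs_sub ((((n : ℕ) : ℤ) - (a : ℕ) : ℤ) : ℝ) (-(t' - t))
      rw [abs_neg, sub_neg_eq_add] at h4
      linarith

theorem phiPair_injective {η η' : Ultrafilter ℕ+} (hη : η ∈ NStar) (hη' : η' ∈ NStar)
    {t t' : ℝ} (ht : t ∈ Set.Ico (0 : ℝ) 1) (ht' : t' ∈ Set.Ico (0 : ℝ) 1)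
    (h : phiPair η t = phiPair η' t') : η = η' ∧ t = t' := by
  by_contra hne
  obtain ⟨A, hA, δ, hδ, hδ1, hAδ⟩ := exists_separating_set ht ht' hne
  let E : Set ℝ := (fun a : ℕ+ => ((a : ℕ) + t : ℝ)) '' A
  have hE : E.Nonempty := (Ultrafilter.nonempty_of_mem hA).image _
  let g : ℝ → ℝ := fun x => min 1 (Metric.infDist x E)
  have hgb : ∀ x, |g x| ≤ 1 := fun x => by
    rw [abs_of_nonneg (le_min zero_le_one Metric.infDist_nonneg)]
    exact min_le_left _ _
  have hgL : LipschitzWith 1 g := (Metric.lipschitz_infDist_pt E).const_min 1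
  obtain ⟨f, hf⟩ := exists_tendsto_phiPair hgb hgL
  have h0 : phiPair η t f = 0 := by
    refine tendsto_nhds_unique (hf η hη t) (tendsto_const_nhds.congr' ?_)
    filter_upwards [hA] with n hn
    have : Metric.infDist ((n : ℕ) + t : ℝ) E = 0 :=
      Metric.infDist_zero_of_mem (Set.mem_image_of_mem _ hn)
    simp [g, this]
  have h1 : δ ≤ phiPair η' t' f := by
    refine ge_of_tendsto (hf η' hη' t') ?_
    filter_upwards [hAδ] with n hn
    refine le_min hδ1 ((Metric.le_infDist hE).2 ?_)
    rintro _ ⟨a, ha, rfl⟩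
    exact hn a ha
  rw [← h, h0] at h1
  exact absurd h1 (not_le.2 hδ)

/-! ### The suspension of the space of free ultrafilters -/

theorem mk_mem_OmegaStar_iff {p : Ultrafilter ℕ+ × Set.Icc (0 : ℝ) 1} :
    Quot.mk glue p ∈ OmegaStar ↔ p.1 ∈ NStar := by
  -- Freeness of the first coordinate is invariant under the identification.
  let P : Omega → Prop := Quot.lift (fun p => p.1 ∈ NStar) (by
    rintro ⟨η, t⟩ q ⟨-, rfl⟩
    exact propext tau_mem_NStar_iff.symm)
  constructor
  · rintro ⟨η, hη, t, h⟩
    exact (congrArg P h).mpr hη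
  · exact fun h => ⟨p.1, h, p.2, rfl⟩

theorem isClosed_OmegaStar : IsClosed OmegaStar := by
  rw [← (isQuotientMap_quot_mk (r := glue)).isClosed_preimage]
  have : Quot.mk glue ⁻¹' OmegaStar = Prod.fst ⁻¹' NStar := Set.ext fun _ => mk_mem_OmegaStar_iff
  rw [this]
  exact isClosed_NStar.preimage continuous_fst

/-- Each point of `OmegaStar` is represented by a pair with second coordinate in `[0, 1)`. -/
theorem exists_mk_eq_of_mem_OmegaStar {ω : Omega} (hω : ω ∈ OmegaStar) :
    ∃ η ∈ NStar, ∃ t : Set.Icc (0 : ℝ) 1, (t : ℝ) < 1 ∧ ω = Quot.mk glue (η, t) := by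
  obtain ⟨η, hη, t, rfl⟩ := hω
  rcases t.2.2.lt_or_eq with h | h
  · exact ⟨η, hη, t, h, rfl⟩
  · exact ⟨tau η, tau_mem_NStar_iff.2 hη, 0, zero_lt_one, Quot.sound ⟨Subtype.ext h, rfl⟩⟩

theorem phi_injOn : Set.InjOn phi OmegaStar := by
  intro ω hω ω' hω' h
  obtain ⟨η, hη, t, ht, rfl⟩ := exists_mk_eq_of_mem_OmegaStar hω
  obtain ⟨η', hη', t', ht', rfl⟩ := exists_mk_eq_of_mem_OmegaStar hω'
  obtain ⟨rfl, h'⟩ := phiPair_injective hη hη' ⟨t.2.1, ht⟩ ⟨t'.2.1, ht'⟩ h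
  rw [Subtype.ext h']

theorem phi_image_OmegaStar : phi '' OmegaStar = CTilde := by
  ext φ
  constructor
  · rintro ⟨_, ⟨η, hη, t, rfl⟩, rfl⟩
    exact phiPair_mem_CTilde hη t.2.1
  · rintro ⟨U, hU, rfl⟩
    obtain ⟨η, hη, t, ht, h⟩ := exists_phiPair_eq_cesaroLim hU
    exact ⟨Quot.mk glue (η, ⟨t, ht⟩), mk_mem_OmegaStar_iff.2 hη, h⟩

/-! ### Continuity -/

/-- For free `η` the functional `phiPair η t` depends continuously on `t`, uniformly in `η`. -/
theorem abs_phiPair_sub_le {η : Ultrafilter ℕ+} (hη : η ∈ NStar) (f : LInf) (s t : ℝ) :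
    |phiPair η s f - phiPair η t f| ≤ ‖f‖ * (2 * |1 - (2 : ℝ) ^ (t - s)|) := by
  have has := tendsto_two_rpow_mul_pow hη s
  have hr : Tendsto (fun n : ℕ+ => ‖f‖ * (2 * |1 - (2 : ℝ) ^ (t - s)| +
      ((2 : ℝ) ^ s * 2 ^ (n : ℕ))⁻¹)) η (𝓝 (‖f‖ * (2 * |1 - (2 : ℝ) ^ (t - s)|))) := by
    simpa using ((tendsto_inv_atTop_zero.comp has).const_add
      (2 * |1 - (2 : ℝ) ^ (t - s)|)).const_mul ‖f‖
  rw [phiPair_apply, phiPair_apply]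
  refine le_of_tendsto_of_tendsto'
    ((tendsto_uLim_mean η f fun n : ℕ+ => two_rpow_mul_pow_pos s n).sub
      (tendsto_uLim_mean η f fun n : ℕ+ => two_rpow_mul_pow_pos t n)).abs hr fun n => ?_
  have hs := two_rpow_mul_pow_pos s n
  refine (abs_mean_sub_mean_le f hs (two_rpow_mul_pow_pos t n)).trans_eq ?_
  have h1 : (2 : ℝ) ^ s * 2 ^ (n : ℕ) - (2 : ℝ) ^ t * 2 ^ (n : ℕ) =
      (1 - (2 : ℝ) ^ (t - s)) * ((2 : ℝ) ^ s * 2 ^ (n : ℕ)) := by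
    rw [Real.rpow_sub two_pos]
    field_simp
  rw [h1, abs_mul, abs_of_pos hs]
  field_simp

theorem continuousOn_phiPair :
    ContinuousOn (fun p : Ultrafilter ℕ+ × ℝ => phiPair p.1 p.2) (Prod.fst ⁻¹' NStar) := by
  rw [continuousOn_iff_continuous_domRestrict]
  refine WeakDual.continuous_of_continuous_eval fun f => ?_
  refine continuous_iff_continuousAt.2 fun ⟨⟨η, t⟩, hη⟩ => ?_
  have h1 : Continuous fun q : (Prod.fst ⁻¹' NStar : Set (Ultrafilter ℕ+ × ℝ)) =>
      phiPair q.1.1 t f :=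
    (continuous_uLim (fun n : ℕ+ => mean f ((2 : ℝ) ^ t * 2 ^ (n : ℕ))) ‖f‖
      fun n => abs_mean_le_norm f (two_rpow_mul_pow_pos t n).le).comp
      (continuous_fst.comp continuous_subtype_val)
  have h2 : Continuous fun q : (Prod.fst ⁻¹' NStar : Set (Ultrafilter ℕ+ × ℝ)) =>
      ‖f‖ * (2 * |1 - (2 : ℝ) ^ (t - q.1.2)|) := by
    refine continuous_const.mul (continuous_const.mul (continuous_const.sub ?_).abs)
    exact (Real.continuous_const_rpow two_ne_zero).comp
      (continuous_const.sub (continuous_snd.comp continuous_subtype_val))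
  have h3 := h2.tendsto ⟨(η, t), hη⟩
  simp only [sub_self, Real.rpow_zero, abs_zero, mul_zero] at h3
  have h4 := (squeeze_zero_norm (fun q => abs_phiPair_sub_le q.2 f q.1.2 t) h3).add
    (h1.tendsto ⟨(η, t), hη⟩)
  simpa [ContinuousAt, Set.domRestrict] using h4

theorem continuousOn_phi : ContinuousOn phi OmegaStar := by
  -- Both `OmegaStar` and its preimage are closed, so it suffices to pull back closed sets to
  -- the pairs with free first coordinate.
  refine continuousOn_iff_isClosed.2 fun C hC => ⟨OmegaStar ∩ phi ⁻¹' C, ?_, by grind⟩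
  rw [← (isQuotientMap_quot_mk (r := glue)).isClosed_preimage]
  have hc : ContinuousOn (fun p : Ultrafilter ℕ+ × Set.Icc (0 : ℝ) 1 => phi (Quot.mk glue p))
      (Quot.mk glue ⁻¹' OmegaStar) :=
    continuousOn_phiPair.comp (f := fun p : Ultrafilter ℕ+ × Set.Icc (0 : ℝ) 1 =>
      (p.1, (p.2 : ℝ))) (by fun_prop) fun p hp => mk_mem_OmegaStar_iff.1 hp
  exact hc.preimage_isClosed_of_isClosed (isClosed_OmegaStar.preimage continuous_quot_mk) hC

theorem theorem3p1 :
    (∀ φ ∈ CTilde, ∃! ω : OmegaStar, φ = phi ω) ∧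
      ∃ h : OmegaStar ≃ₜ CTilde, ∀ ω : OmegaStar, (h ω : WeakDual ℝ LInf) = phi ω := by
  have hbij : Set.BijOn phi OmegaStar CTilde :=
    phi_image_OmegaStar ▸ phi_injOn.bijOn_image
  refine ⟨fun φ hφ => ?_, ?_⟩
  · obtain ⟨ω, hω, rfl⟩ := hbij.surjOn hφ
    exact ⟨⟨ω, hω⟩, rfl, fun ω' h => Subtype.ext (phi_injOn ω'.2 hω h.symm)⟩
  · have : CompactSpace OmegaStar := isCompact_iff_compactSpace.1 isClosed_OmegaStar.isCompact
    have hc : Continuous (hbij.equiv phi) :=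
      (continuousOn_iff_continuous_domRestrict.1 continuousOn_phi).subtype_mk _
    exact ⟨hc.homeoOfEquivCompactToT2, fun _ => rfl⟩
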